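/- **Setting.** Let $\mathsf{Voc}$ be a finite vocabulary with orthonormal embeddings $\mathsf E(v)\in\mathbb R^d$, embedding matrix $\mathbf U=[\mathsf E(v)]_{v\in\mathsf{Voc}}$, and two distinct special tokens $\texttt{<A>},\texttt{<R>}$. An *instance* consists of a directed graph $\mathcal G=(\mathcal V,\mathcal E)$ with $\mathcal V\subseteq\mathsf{Voc}\setminus\{\texttt{<A>},\texttt{<R>}\}$, a root $r\in\mathcal V$, two candidates $c_1,c_2\in\mathcal V$ of which exactly one, called $c_\star$, is reachable from $r$, a number of steps $C$, and weights $(\lambda_v)_v$. Let $\mathcal N_C$ be the set of vertices reachable from $r$ within $C$ steps. The instance is *admissible* if $c_\star\in\mathcal N_C$, $\lambda_v\in(0,1]$ for $v\in\mathcal N_C$, and $\lambda_v=0$ otherwise. For parameters $w=(\mu_A,\mu_R)\in\mathbb R^2$ put $$h_A=\sum_{v\in\mathcal N_C}\lambda_v\mathsf E(v)+\mathsf E(\texttt{<A>}),\quad h_R=\mathsf E(\texttt{<R>})+\mathsf E(c_1)+\mathsf E(c_2),\quad \mathbf W=\mu_R\,\mathsf E(\texttt{<A>})\mathsf E(\texttt{<R>})^\top,$$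 $$\xi(w)=\mathbf U^\top\big(\mu_A h_A+(h_A^\top\mathbf W h_R)\,h_R\big),\qquad p_{c_\star}(w)=\frac{e^{\xi_{c_\star}(w)}}{\sum_{v\in\mathcal V}e^{\xi_v(w)}},\qquad \ell(w)=-\log p_{c_\star}(w).$$ Given $N\ge1$ admissible training instances (indexed by $i$), let $\mathcal L=\frac1N\sum_i\ell^{(i)}$ and let $w(t)=(\mu_A(t),\mu_R(t))$, $t\ge0$, solve $\dot w=-\alpha\nabla\mathcal L(w)$ with $\alpha>0$, from an arbitrary $w(0)\in\mathbb R^2$. Put $x_v^{(i)}=(\lambda_v^{(i)},\mathbb 1\{v\in\{c_1^{(i)},c_2^{(i)}\}\})$ and define, for unit vectors $u=(u_A,u_R)$ with $u_A,u_R\ge0$, the margin $\gamma(u)=\min_i\min_{v\in\mathcal V^{(i)},\,v\ne c_\star^{(i)}}\langle u,x^{(i)}_{c_\star}-x^{(i)}_v\rangle$. Let $$\lambda_\star=\min_i\lambda^{(i)}_{c_\star},\qquad \delta=\max_i\max_{v\in\mathcal N_C^{(i)}\setminus\{c_\star^{(i)}\}}\big(\lambda_v^{(i)}-\lambda_{c_\star}^{(i)}\big),\qquad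 \Delta_{\rm train}=\max_i\max_{v\in\mathcal N_C^{(i)}\setminus\{c_\star^{(i)}\}}\big(\lambda_v^{(i)}-\lambda_{c_\star}^{(i)}\big)_+ .$$ **Theorem.** (a) The margin $\gamma$ has a unique maximizer $u^\star$ over the unit vectors with nonnegative coordinates, and as $t\to\infty$, $\|w(t)\|\to\infty$ and $w(t)/\|w(t)\|\to u^\star$. (b) Suppose that some training instance $i$ has a vertex $v\in\mathcal N_C^{(i)}\setminus\{c_\star^{(i)}\}$ with $\lambda_{c_\star}^{(i)}-\lambda_v^{(i)}<\lambda_\star$ (this is automatic if $c_\star^{(i)}\ne r^{(i)}$ for all $i$). Then $u_A^\star,u_R^\star>0$ and $u_R^\star/u_A^\star=\lambda_\star+\delta$; in particular $u_R^\star/u_A^\star=\lambda_\star+\Delta_{\rm train}$ as soon as some training instance has a vertex $v\in\mathcal N_C^{(i)}\setminus\{c_\star^{(i)}\}$ with $\lambda_v^{(i)}\ge\lambda_{c_\star}^{(i)}$. Moreover, for every admissible (unseen) instance over the same vocabulary with $\max_{v}\lambda_v-\lambda_{c_\star}\le\Delta_{\rm train}$, one has $p_{c_\star}(w(t))\to1$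 as $t\to\infty$. -/

import Mathlib

open Filter Topology
open scoped Matrix

noncomputable section

namespace PredictionStage

variable {Voc : Type*} [Fintype Voc] [DecidableEq Voc] {d : ℕ}

/-- Token embeddings `E : Voc → ℝ^d` with orthonormal values, together with the two special
tokens, the answer token and the reasoning token. -/
structure TokenModel (Voc : Type*) [DecidableEq Voc] (d : ℕ) where
  emb : Voc → Fin d → ℝ
  orthonormal : ∀ u v, emb u ⬝ᵥ emb v = if u = v then 1 else 0
  ansTok : Voc
  reasTok : Voc
  ans_ne_reas : ansTok ≠ reasTok

/-- `U = [E(1), …, E(M)]`. -/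
def TokenModel.unembed (T : TokenModel Voc d) : Matrix (Fin d) Voc ℝ :=
  Matrix.of fun a v => T.emb v a

/-- The vertices reachable from `r` within `c` steps. -/
def ball (G : Digraph Voc) (r : Voc) : ℕ → Set Voc
  | 0 => {r}
  | c + 1 => ball G r c ∪ {v | ∃ u ∈ ball G r c, G.Adj u v}

/-- `v` is reachable from `r` along directed edges. -/
def Reachable (G : Digraph Voc) (r v : Voc) : Prop :=
  Relation.ReflTransGen G.Adj r v

/-- An instance of the graph reachability problem with the weights of its final continuous
thought: a directed graph on a finite set of vertex tokens (none of them a special token), a root,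
two candidates exactly one of which is reachable from the root, the number `steps` of continuous
thoughts, and the thought weights. -/
structure Instance (T : TokenModel Voc d) where
  verts : Finset Voc
  ans_notMem : T.ansTok ∉ verts
  reas_notMem : T.reasTok ∉ verts
  graph : Digraph Voc
  adj_mem : ∀ u v, graph.Adj u v → u ∈ verts ∧ v ∈ verts
  root : Voc
  root_mem : root ∈ verts
  cand₁ : Voc
  cand₁_mem : cand₁ ∈ verts
  cand₂ : Voc
  cand₂_mem : cand₂ ∈ verts
  one_reachable : Xor (Reachable graph root cand₁) (Reachable graph root cand₂)
  steps : ℕ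
  weight : Voc → ℝ

namespace Instance

variable {T : TokenModel Voc d} (I : Instance T)

open Classical in
/-- The vertices reachable from the root within `steps` steps. -/
def nbhd : Finset Voc :=
  {v ∈ I.verts | v ∈ ball I.graph I.root I.steps}

open Classical in
/-- The reachable candidate. -/
def cStar : Voc :=
  if Reachable I.graph I.root I.cand₁ then I.cand₁ else I.cand₂

/-- The number of thoughts suffices to reach the reachable candidate; the thought weights lie in
`(0, 1]` on the explored set and vanish elsewhere. -/
structure Admissible : Prop where
  cStar_mem : I.cStar ∈ I.nbhd
  weight_pos : ∀ v ∈ I.nbhd, 0 < I.weight v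
  weight_le_one : ∀ v ∈ I.nbhd, I.weight v ≤ 1
  weight_eq_zero : ∀ v, v ∉ I.nbhd → I.weight v = 0

/-- The last continuous thought, a weighted superposition of the explored vertices. -/
def thought : Fin d → ℝ :=
  ∑ v ∈ I.nbhd, I.weight v • T.emb v

/-- Hidden state at the answer token. -/
def hAns : Fin d → ℝ :=
  I.thought + T.emb T.ansTok

/-- Hidden state at the reasoning token. -/
def hReas : Fin d → ℝ :=
  T.emb T.reasTok + T.emb I.cand₁ + T.emb I.cand₂

end Instance

/-- Attention matrix `W = μ_R E(A) E(R)ᵀ`. -/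
def attnMatrix (T : TokenModel Voc d) (μR : ℝ) : Matrix (Fin d) (Fin d) ℝ :=
  μR • Matrix.vecMulVec (T.emb T.ansTok) (T.emb T.reasTok)

/-- Linear attention with identity value matrix: `∑ i, (hᵀ W hᵢ) hᵢ`. -/
def linAttn {κ : Type*} [Fintype κ] (W : Matrix (Fin d) (Fin d) ℝ) (h : Fin d → ℝ)
    (hs : κ → Fin d → ℝ) : Fin d → ℝ :=
  ∑ i, (h ⬝ᵥ (W *ᵥ hs i)) • hs i

namespace Instance

variable {T : TokenModel Voc d} (I : Instance T)

/-- Logit vector of the forward pass at parameters `w = (μ_A, μ_R)`; the answer position attends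
to the single reasoning position. -/
def logits (w : EuclideanSpace ℝ (Fin 2)) : Voc → ℝ :=
  T.unembedᵀ *ᵥ (w 0 • I.hAns + linAttn (attnMatrix T (w 1)) I.hAns (fun _ : Unit => I.hReas))

/-- Softmax probability, over the vertices, of the reachable candidate. -/
def prob (w : EuclideanSpace ℝ (Fin 2)) : ℝ :=
  Real.exp (I.logits w I.cStar) / ∑ v ∈ I.verts, Real.exp (I.logits w v)

/-- Cross-entropy loss of the instance. -/
def loss (w : EuclideanSpace ℝ (Fin 2)) : ℝ :=
  -Real.log (I.prob w)

/-- Two-dimensional feature `x_v = (λ_v, 1{v ∈ {c₁, c₂}})`. -/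
def feature (v : Voc) : EuclideanSpace ℝ (Fin 2) :=
  !₂[I.weight v, if v = I.cand₁ ∨ v = I.cand₂ then 1 else 0]

end Instance

variable {T : TokenModel Voc d} {N : ℕ}

/-- Average training loss. -/
def trainLoss (train : Fin N → Instance T) (w : EuclideanSpace ℝ (Fin 2)) : ℝ :=
  (1 / (N : ℝ)) * ∑ i, (train i).loss w

/-- Gradient flow `ẇ = -α ∇L(w)` on `[0, ∞)`. -/
def IsGradientFlow (L : EuclideanSpace ℝ (Fin 2) → ℝ) (α : ℝ)
    (w : ℝ → EuclideanSpace ℝ (Fin 2)) : Prop :=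
  ∀ t, 0 ≤ t → HasDerivWithinAt w (-(α • gradient L (w t))) (Set.Ici 0) t

/-- Hard margin of a direction: the minimum over training instances and competing vertices of
`⟪u, x_{c⋆} - x_v⟫`. -/
def margin (train : Fin N → Instance T) (u : EuclideanSpace ℝ (Fin 2)) : ℝ :=
  sInf {m : ℝ | ∃ i, ∃ v ∈ (train i).verts, v ≠ (train i).cStar ∧
    m = inner ℝ u ((train i).feature (train i).cStar - (train i).feature v)}

/-- Unit vectors with nonnegative coordinates. -/
def directions : Set (EuclideanSpace ℝ (Fin 2)) :=
  {u | ‖u‖ = 1 ∧ 0 ≤ u 0 ∧ 0 ≤ u 1}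

/-- `u` solves the maximum-margin problem. -/
def IsMaxMargin (train : Fin N → Instance T) (u : EuclideanSpace ℝ (Fin 2)) : Prop :=
  u ∈ directions ∧ IsMaxOn (margin train) directions u

/-- `λ_⋆`, the smallest weight of a reachable candidate in the training set. -/
def lamStar (train : Fin N → Instance T) : ℝ :=
  ⨅ i, (train i).weight (train i).cStar

/-- Largest difference `λ_v - λ_{c⋆}` over the training set, over explored vertices `v ≠ c⋆`. -/
def signedOvershoot (train : Fin N → Instance T) : ℝ :=
  sSup {x : ℝ | ∃ i, ∃ v ∈ (train i).nbhd, v ≠ (train i).cStar ∧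
    x = (train i).weight v - (train i).weight (train i).cStar}

/-- `Δ_train`, the largest positive part `(λ_v - λ_{c⋆})₊` over the training set, over explored
vertices `v ≠ c⋆` (and `0` if there is no such vertex). -/
def deltaTrain (train : Fin N → Instance T) : ℝ :=
  sSup {x : ℝ | ∃ i, ∃ v ∈ (train i).nbhd, v ≠ (train i).cStar ∧
    x = max ((train i).weight v - (train i).weight (train i).cStar) 0}

end PredictionStage

end

/-! The attention score collapses to `μ_R`, so on vertices the logits are linear, `ξ_v = ⟪x_v, w⟫`,
and the training loss is a convex average of log-sum-exps of the gaps `x_v - x_{c⋆}`. Two facts are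
then combined.

Geometry: a competitor is either the other candidate (margin `w₀ λ_{c⋆}`) or a non-candidate (margin
`w₁ - w₀ (λ_v - λ_{c⋆})`). Equalizing the tightest constraint of each kind gives slope `ρ = λ⋆ + δ`;
if this is not forced to be positive, slope `0` is optimal. A convex combination of the tight
constraints equals `g ⟪·, u⟫`, so for every `w` some margin is at most `g ⟪w, u⟫`. This certificate
(`IsMarginCertificate`) yields optimality and uniqueness of `u`.

Dynamics: the same certificate bounds the loss below by `(1/N) log (1 + exp (-g ‖w‖))` everywhere
and above by `|Voc| exp (-g s)` at `s • u`. Convex gradient flow drives the loss to its infimum `0`,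
so `‖w‖ → ∞`. At large norm, moving to `(1 + ε) ‖w‖ • u` does not increase the loss, and convexity
turns this into alignment with `u` (`tendsto_direction_of_gradientFlow`). -/

namespace PredictionStage

/-! ### Gradient flow of a convex function -/

section GradientFlow

variable {F : Type*} [NormedAddCommGroup F] [InnerProductSpace ℝ F] [CompleteSpace F]
  {L : F → ℝ} {α : ℝ} {w : ℝ → F}

/-- The loss is nonincreasing along gradient flow. -/
theorem antitoneOn_loss_of_gradientFlow (hL : Differentiable ℝ L) (hα : 0 < α)
    (hw : ∀ t, 0 ≤ t → HasDerivWithinAt w (-(α • gradient L (w t))) (Set.Ici 0) t) :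
    AntitoneOn (fun t => L (w t)) (Set.Ici 0) := by
  refine antitoneOn_of_hasDerivWithinAt_nonpos (convex_Ici 0)
    (f' := fun t => fderiv ℝ L (w t) (-(α • gradient L (w t)))) ?_ ?_ ?_
  · exact fun t ht => (hL _).continuousAt.comp_continuousWithinAt (hw t ht).continuousWithinAt
  · intro t ht
    have ht' : (0 : ℝ) ≤ t := interior_subset ht
    exact ((hL (w t)).hasFDerivAt.comp_hasDerivWithinAt t (hw t ht')).mono interior_subset
  · intro t _
    rw [← inner_gradient_left, inner_neg_right, inner_smul_right, real_inner_self_eq_norm_sq]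
    have : 0 ≤ α * ‖gradient L (w t)‖ ^ 2 := by positivity
    linarith

/-- Gradient flow of a convex function eventually gets below every value exceeding some value of
the function. -/
theorem eventually_loss_lt_of_gradientFlow (hL : Differentiable ℝ L)
    (hconv : ∀ x z, L x + fderiv ℝ L x (z - x) ≤ L z) (hα : 0 < α)
    (hw : ∀ t, 0 ≤ t → HasDerivWithinAt w (-(α • gradient L (w t))) (Set.Ici 0) t)
    {η : ℝ} {z : F} (hz : L z < η) : ∀ᶠ t in atTop, L (w t) < η := by
  have hanti := antitoneOn_loss_of_gradientFlow hL hα hw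
  by_cases h : ∃ s, 0 ≤ s ∧ L (w s) < η
  · obtain ⟨s, hs, hsη⟩ := h
    filter_upwards [eventually_ge_atTop s] with t ht
    exact (hanti hs (hs.trans ht) ht).trans_lt hsη
  push Not at h
  exfalso
  -- As long as `L (w t) ≥ η`, convexity makes `‖w t - z‖ ^ 2` decrease at rate at least `c`, which
  -- cannot last forever.
  set c : ℝ := 2 * α * (η - L z) with hc
  have hc0 : 0 < c := by have := sub_pos.2 hz; positivity
  have key : AntitoneOn (fun t => ‖w t - z‖ ^ 2 + c * t) (Set.Ici 0) := by
    refine antitoneOn_of_hasDerivWithinAt_nonpos (convex_Ici 0)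
      (f' := fun t => 2 * inner ℝ (w t - z) (-(α • gradient L (w t))) + c) ?_ ?_ ?_
    · intro t ht
      exact ((((hw t ht).continuousWithinAt.sub continuousWithinAt_const).norm).pow 2).add
        (by fun_prop)
    · intro t ht
      have ht' : (0 : ℝ) ≤ t := interior_subset ht
      have h1 := (((hw t ht').sub_const z).norm_sq).mono (interior_subset (s := Set.Ici (0 : ℝ)))
      have h2 := ((hasDerivWithinAt_id t (interior (Set.Ici (0 : ℝ)))).const_mul c)
      simpa using h1.fun_add h2
    · intro t ht
      have ht' : (0 : ℝ) ≤ t := interior_subset ht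
      have h1 := hconv (w t) z
      rw [← inner_gradient_left, ← neg_sub, inner_neg_right, real_inner_comm] at h1
      rw [inner_neg_right, inner_smul_right]
      have h2 := h t ht'
      have h3 : α * (η - L z) ≤ α * inner ℝ (w t - z) (gradient L (w t)) := by gcongr; linarith
      linarith
  -- By this time the squared distance would be at most `-1`.
  have hT : 0 ≤ (‖w 0 - z‖ ^ 2 + 1) / c := by positivity
  have h1 := key (Set.self_mem_Ici) hT hT
  simp only [mul_zero, add_zero] at h1
  rw [mul_div_cancel₀ _ hc0.ne'] at h1
  nlinarith [sq_nonneg ‖w ((‖w 0 - z‖ ^ 2 + 1) / c) - z‖]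

/-- Gradient flow of a convex function follows the direction `u` if its norm diverges and, at large
norm, moving to a slightly longer multiple of `u` does not increase the function. -/
theorem tendsto_direction_of_gradientFlow
    (hconv : ∀ x z, L x + fderiv ℝ L x (z - x) ≤ L z) (hα : 0 < α)
    (hw : ∀ t, 0 ≤ t → HasDerivWithinAt w (-(α • gradient L (w t))) (Set.Ici 0) t)
    (hnorm : Tendsto (fun t => ‖w t‖) atTop atTop) {u : F} (hu : ‖u‖ = 1)
    (hpath : ∀ ε : ℝ, 0 < ε → ∃ R : ℝ, ∀ x, R ≤ ‖x‖ → L (((1 + ε) * ‖x‖) • u) ≤ L x) :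
    Tendsto (fun t => (‖w t‖)⁻¹ • w t) atTop (𝓝 u) := by
  have hlow : ∀ ε : ℝ, 0 < ε →
      ∀ᶠ t in atTop, ‖w t‖ * (1 - ε) ≤ (1 + ε) * inner ℝ (w t) u := by
    intro ε hε
    obtain ⟨R, hR⟩ := hpath ε hε
    obtain ⟨s, hs⟩ := eventually_atTop.1
      ((hnorm.eventually_ge_atTop (max R 1)).and (eventually_ge_atTop 0))
    -- Convexity and `hpath` give `⟪∇L, (1 + ε) ‖w‖ u - w⟫ ≤ 0`; divided by `‖w‖`, this is the sign
    -- of the derivative.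
    have hmono : MonotoneOn (fun t => (1 + ε) * inner ℝ (w t) u - ‖w t‖) (Set.Ici s) := by
      have hd : ∀ t ∈ Set.Ici s, HasDerivWithinAt (fun t => (1 + ε) * inner ℝ (w t) u - ‖w t‖)
          ((1 + ε) * inner ℝ (-(α • gradient L (w t))) u
            - inner ℝ (w t) (-(α • gradient L (w t))) / ‖w t‖) (Set.Ici s) t := by
        intro t ht
        have hpos : 0 < ‖w t‖ := lt_of_lt_of_le one_pos ((le_max_right R 1).trans (hs t ht).1)
        have h0 := (hw t (hs t ht).2).mono (Set.Ici_subset_Ici.2 (hs s le_rfl).2)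
        have h1 := (h0.inner ℝ (hasDerivWithinAt_const t (Set.Ici s) u)).const_mul (1 + ε)
        have h2 := h0.norm_sq.sqrt (by positivity)
        simp only [Real.sqrt_sq, norm_nonneg] at h2
        refine (h1.fun_sub h2).congr_deriv ?_
        simp only [inner_zero_right, zero_add]
        congr 1
        field_simp
      refine monotoneOn_of_hasDerivWithinAt_nonneg (convex_Ici s)
        (fun t ht => (hd t ht).continuousWithinAt)
        (fun t ht => (hd t (interior_subset ht)).mono interior_subset) ?_
      intro t ht
      have ht := hs t (interior_subset ht)
      have hpos : 0 < ‖w t‖ := lt_of_lt_of_le one_pos ((le_max_right R 1).trans ht.1)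
      have h1 := hR (w t) ((le_max_left R 1).trans ht.1)
      have h2 := hconv (w t) (((1 + ε) * ‖w t‖) • u)
      rw [← inner_gradient_left, inner_sub_right, inner_smul_right] at h2
      rw [inner_neg_right, inner_neg_left, inner_smul_right, real_inner_smul_left,
        real_inner_comm (gradient L (w t)) (w t)]
      have h3 : (1 + ε) * inner ℝ (gradient L (w t)) u
          ≤ inner ℝ (gradient L (w t)) (w t) / ‖w t‖ := by
        rw [le_div_iff₀ hpos]; linarith
      have h4 := mul_le_mul_of_nonneg_left h3 hα.le
      rw [neg_div, mul_div_assoc]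
      linarith
    -- The value at time `s` is a constant, absorbed by `ε ‖w t‖` once the norm is large.
    filter_upwards [eventually_ge_atTop s,
      hnorm.eventually_ge_atTop (-((1 + ε) * inner ℝ (w s) u - ‖w s‖) / ε)] with t ht ht2
    have h1 := hmono Set.self_mem_Ici ht ht
    simp only at h1
    rw [div_le_iff₀ hε] at ht2
    linarith
  rw [Metric.tendsto_nhds]
  intro η hη
  -- With cosine `a ≥ (1 - ε) / (1 + ε)`, the squared distance `2 - 2a` is at most `4ε = η ^ 2 / 2`.
  filter_upwards [hlow (η ^ 2 / 8) (by positivity), hnorm.eventually_gt_atTop 0] with t h1 h2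
  rw [dist_eq_norm]
  refine lt_of_pow_lt_pow_left₀ 2 hη.le ?_
  rw [norm_sub_sq_real, norm_smul, norm_inv, norm_norm, inv_mul_cancel₀ h2.ne', hu,
    real_inner_smul_left]
  set a : ℝ := (‖w t‖)⁻¹ * inner ℝ (w t) u with ha
  have h3 : (inner ℝ (w t) u : ℝ) = ‖w t‖ * a := by rw [ha]; field_simp
  rw [h3, mul_left_comm] at h1
  have h4 := le_of_mul_le_mul_left h1 h2
  have hε : 0 < η ^ 2 := by positivity
  by_contra hcon
  push Not at hcon
  nlinarith

end GradientFlow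

/-! ### Convexity of log-sum-exp -/

section LogSumExp

variable {F : Type*} [NormedAddCommGroup F] [InnerProductSpace ℝ F] {ι : Type*}

/-- `log ∑ exp ⟪y, w⟫` over a finite family of vectors `y`. -/
noncomputable def logSumExp (S : Finset ι) (y : ι → F) (w : F) : ℝ :=
  Real.log (∑ v ∈ S, Real.exp (inner ℝ (y v) w))

theorem sum_exp_inner_pos {S : Finset ι} (hS : S.Nonempty) (y : ι → F) (w : F) :
    0 < ∑ v ∈ S, Real.exp (inner ℝ (y v) w) :=
  Finset.sum_pos (fun _ _ => Real.exp_pos _) hS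

theorem hasFDerivAt_logSumExp {S : Finset ι} (hS : S.Nonempty) (y : ι → F) (w : F) :
    HasFDerivAt (logSumExp S y) ((∑ v ∈ S, Real.exp (inner ℝ (y v) w))⁻¹ •
      ∑ v ∈ S, Real.exp (inner ℝ (y v) w) • innerSL ℝ (y v)) w := by
  refine HasFDerivAt.log ?_ (sum_exp_inner_pos hS y w).ne'
  exact HasFDerivAt.fun_sum fun v _ => ((innerSL ℝ (y v)).hasFDerivAt (x := w)).exp

theorem differentiable_logSumExp {S : Finset ι} (hS : S.Nonempty) (y : ι → F) :
    Differentiable ℝ (logSumExp S y) :=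
  fun w => (hasFDerivAt_logSumExp hS y w).differentiableAt

/-- Jensen for `exp` under the softmax weights at `x`: the mean of `⟪y v, z - x⟫` is the derivative,
and the mean of its exponential is the ratio of the partition sums at `z` and `x`. -/
theorem logSumExp_add_fderiv_le {S : Finset ι} (hS : S.Nonempty) (y : ι → F) (x z : F) :
    logSumExp S y x + fderiv ℝ (logSumExp S y) x (z - x) ≤ logSumExp S y z := by
  rw [(hasFDerivAt_logSumExp hS y x).fderiv]
  set Z := ∑ v ∈ S, Real.exp (inner ℝ (y v) x) with hZ
  have hZ0 : 0 < Z := sum_exp_inner_pos hS y x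
  have hJ := convexOn_exp.map_sum_le (t := S) (w := fun v => Z⁻¹ * Real.exp (inner ℝ (y v) x))
    (p := fun v => inner ℝ (y v) (z - x)) (fun v _ => by positivity)
    (by rw [← Finset.mul_sum, ← hZ, inv_mul_cancel₀ hZ0.ne']) (fun v _ => Set.mem_univ _)
  have h1 : ∑ v ∈ S, (Z⁻¹ * Real.exp (inner ℝ (y v) x)) • Real.exp (inner ℝ (y v) (z - x))
      = Z⁻¹ * ∑ v ∈ S, Real.exp (inner ℝ (y v) z) := by
    rw [Finset.mul_sum]
    refine Finset.sum_congr rfl fun v _ => ?_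
    rw [smul_eq_mul, mul_assoc, ← Real.exp_add, inner_sub_right, add_sub_cancel]
  rw [h1] at hJ
  have h2 : ((Z⁻¹ • ∑ v ∈ S, Real.exp (inner ℝ (y v) x) • innerSL ℝ (y v)) (z - x) : ℝ)
      = ∑ v ∈ S, (Z⁻¹ * Real.exp (inner ℝ (y v) x)) • inner ℝ (y v) (z - x) := by
    simp [Finset.mul_sum, mul_assoc]
  rw [h2]
  have h3 := (Real.le_log_iff_exp_le (by have := sum_exp_inner_pos hS y z; positivity)).2 hJ
  rw [Real.log_mul (by positivity) (sum_exp_inner_pos hS y z).ne', Real.log_inv] at h3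
  unfold logSumExp
  linarith

end LogSumExp

/-! ### Logits and gaps of a single instance -/

theorem reachable_of_mem_ball {Voc : Type*} {G : Digraph Voc} {r : Voc} {n : ℕ} {v : Voc}
    (h : v ∈ ball G r n) : Reachable G r v := by
  induction n generalizing v with
  | zero =>
    have h' : v = r := h
    exact h' ▸ Relation.ReflTransGen.refl
  | succ n ih =>
    rcases h with h | ⟨u, hu, huv⟩
    · exact ih h
    · exact (ih hu).tail huv

variable {Voc : Type*} [DecidableEq Voc] {d : ℕ}

namespace Instance

variable {T : TokenModel Voc d} (I : Instance T)

/-- `v` is one of the two candidates. -/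
def IsCand (v : Voc) : Prop := v = I.cand₁ ∨ v = I.cand₂

theorem nbhd_subset_verts : I.nbhd ⊆ I.verts := by
  classical
  exact Finset.filter_subset _ _

theorem reachable_of_mem_nbhd {v : Voc} (hv : v ∈ I.nbhd) : Reachable I.graph I.root v := by
  classical
  exact reachable_of_mem_ball (Finset.mem_filter.1 hv).2

theorem isCand_cStar : I.IsCand I.cStar := by
  unfold cStar IsCand
  split_ifs <;> simp

theorem cStar_mem_verts : I.cStar ∈ I.verts := by
  rcases I.isCand_cStar with h | h <;> rw [h]
  exacts [I.cand₁_mem, I.cand₂_mem]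

theorem not_reachable_of_isCand {v : Voc} (hv : I.IsCand v) (hne : v ≠ I.cStar) :
    ¬ Reachable I.graph I.root v := by
  have hx := I.one_reachable
  unfold cStar at hne
  rcases hv with rfl | rfl <;> split_ifs at hne with h
  · exact absurd rfl hne
  · exact h
  · rcases hx with hx | hx
    · exact hx.2
    · exact absurd h hx.2
  · exact absurd rfl hne

theorem not_isCand_of_mem_nbhd {v : Voc} (hv : v ∈ I.nbhd) (hne : v ≠ I.cStar) :
    ¬ I.IsCand v :=
  fun h => I.not_reachable_of_isCand h hne (I.reachable_of_mem_nbhd hv)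

theorem cand₁_ne_cand₂ : I.cand₁ ≠ I.cand₂ := by
  intro h
  have hx := I.one_reachable
  rw [h] at hx
  rcases hx with hx | hx <;> exact hx.2 hx.1

/-- There is a candidate that competes with the reachable one. -/
theorem exists_isCand_ne_cStar : ∃ v ∈ I.verts, v ≠ I.cStar ∧ I.IsCand v := by
  rcases I.isCand_cStar with h | h
  · exact ⟨I.cand₂, I.cand₂_mem, h ▸ I.cand₁_ne_cand₂.symm, Or.inr rfl⟩
  · exact ⟨I.cand₁, I.cand₁_mem, h ▸ I.cand₁_ne_cand₂, Or.inl rfl⟩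

theorem emb_dotProduct_thought (hI : I.Admissible) (v : Voc) :
    T.emb v ⬝ᵥ I.thought = I.weight v := by
  unfold thought
  rw [dotProduct_sum]
  simp only [dotProduct_smul, T.orthonormal, smul_eq_mul, mul_ite, mul_one, mul_zero,
    Finset.sum_ite_eq]
  split_ifs with h
  · rfl
  · exact (hI.weight_eq_zero v h).symm

/-- Special tokens are not vertices, so by orthonormality `h_A` and `h_R` have coefficient `1` on
them and the attention score is exactly `μ_R`. -/
theorem logits_eq (hI : I.Admissible) {v : Voc} (hv : v ∈ I.verts)
    (w : EuclideanSpace ℝ (Fin 2)) : I.logits w v = inner ℝ (I.feature v) w := by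
  have ha : ∀ x ∈ I.verts, x ≠ T.ansTok := fun x hx h => I.ans_notMem (h ▸ hx)
  have hr : ∀ x ∈ I.verts, x ≠ T.reasTok := fun x hx h => I.reas_notMem (h ▸ hx)
  have h1 : I.hAns ⬝ᵥ T.emb T.ansTok = 1 := by
    unfold hAns
    rw [dotProduct_comm, dotProduct_add, I.emb_dotProduct_thought hI, T.orthonormal, if_pos rfl,
      hI.weight_eq_zero _ fun h => I.ans_notMem (I.nbhd_subset_verts h), zero_add]
  have h2 : T.emb T.reasTok ⬝ᵥ I.hReas = 1 := by
    simp [hReas, dotProduct_add, T.orthonormal, (hr _ I.cand₁_mem).symm, (hr _ I.cand₂_mem).symm]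
  have h3 : T.emb v ⬝ᵥ I.hAns = I.weight v := by
    simp [hAns, dotProduct_add, T.orthonormal, I.emb_dotProduct_thought hI, ha v hv]
  have h4 : T.emb v ⬝ᵥ I.hReas = if v = I.cand₁ ∨ v = I.cand₂ then 1 else 0 := by
    have := I.cand₁_ne_cand₂
    simp only [hReas, dotProduct_add, T.orthonormal, hr v hv, if_false]
    by_cases h : v = I.cand₁
    · simp [h, this]
    · simp [h]
  have h5 : linAttn (attnMatrix T (w 1)) I.hAns (fun _ : Unit => I.hReas) = w 1 • I.hReas := by
    simp [linAttn, attnMatrix, Matrix.smul_mulVec, Matrix.vecMulVec_mulVec, h1, h2]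
  have h6 : I.logits w v = T.emb v ⬝ᵥ (w 0 • I.hAns + w 1 • I.hReas) := by
    unfold logits
    rw [h5]
    rfl
  rw [h6, dotProduct_add, dotProduct_smul, dotProduct_smul, h3, h4]
  simp [feature, PiLp.inner_apply, Fin.sum_univ_two]

/-- Logit gap direction of `v` against the reachable candidate. -/
noncomputable def gap (v : Voc) : EuclideanSpace ℝ (Fin 2) := I.feature v - I.feature I.cStar

theorem inner_gap_of_isCand (hI : I.Admissible) {v : Voc} (hne : v ≠ I.cStar) (hv : I.IsCand v)
    (w : EuclideanSpace ℝ (Fin 2)) :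
    inner ℝ (I.gap v) w = -(w 0 * I.weight I.cStar) := by
  have h0 : I.weight v = 0 :=
    hI.weight_eq_zero v fun h => I.not_isCand_of_mem_nbhd h hne hv
  have h1 : v = I.cand₁ ∨ v = I.cand₂ := hv
  have h2 : I.cStar = I.cand₁ ∨ I.cStar = I.cand₂ := I.isCand_cStar
  simp [gap, feature, PiLp.inner_apply, Fin.sum_univ_two, h0, h1, h2]

theorem inner_gap_of_not_isCand {v : Voc} (hv : ¬ I.IsCand v)
    (w : EuclideanSpace ℝ (Fin 2)) :
    inner ℝ (I.gap v) w = -(w 1 - w 0 * (I.weight v - I.weight I.cStar)) := by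
  have h1 : ¬ (v = I.cand₁ ∨ v = I.cand₂) := hv
  have h2 : I.cStar = I.cand₁ ∨ I.cStar = I.cand₂ := I.isCand_cStar
  simp only [gap, feature, PiLp.inner_apply, Fin.sum_univ_two, if_neg h1, if_pos h2]
  simp
  ring

theorem prob_eq (hI : I.Admissible) (w : EuclideanSpace ℝ (Fin 2)) :
    I.prob w = (∑ v ∈ I.verts, Real.exp (inner ℝ (I.gap v) w))⁻¹ := by
  unfold prob
  rw [I.logits_eq hI I.cStar_mem_verts, ← inv_div, Finset.sum_div]
  congr 1
  refine Finset.sum_congr rfl fun v hv => ?_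
  rw [I.logits_eq hI hv, ← Real.exp_sub, gap, inner_sub_left]

theorem loss_eq (hI : I.Admissible) (w : EuclideanSpace ℝ (Fin 2)) :
    I.loss w = logSumExp I.verts I.gap w := by
  rw [loss, I.prob_eq hI, Real.log_inv, neg_neg, logSumExp]

/-- The gap of `c⋆` against itself is zero, which isolates the term `1`. -/
theorem sum_exp_gap_eq (w : EuclideanSpace ℝ (Fin 2)) :
    ∑ v ∈ I.verts, Real.exp (inner ℝ (I.gap v) w)
      = 1 + ∑ v ∈ I.verts.erase I.cStar, Real.exp (inner ℝ (I.gap v) w) := by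
  rw [← Finset.add_sum_erase _ _ I.cStar_mem_verts]
  simp [gap]

/-- Along a diverging path whose direction separates the reachable candidate from every other
vertex, the probability of the reachable candidate tends to `1`. -/
theorem tendsto_prob (hI : I.Admissible) {w : ℝ → EuclideanSpace ℝ (Fin 2)}
    {u : EuclideanSpace ℝ (Fin 2)} (hnorm : Tendsto (fun t => ‖w t‖) atTop atTop)
    (hdir : Tendsto (fun t => (‖w t‖)⁻¹ • w t) atTop (𝓝 u))
    (hu : ∀ v ∈ I.verts, v ≠ I.cStar → inner ℝ (I.gap v) u < 0) :
    Tendsto (fun t => I.prob (w t)) atTop (𝓝 1) := by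
  simp only [I.prob_eq hI, I.sum_exp_gap_eq]
  have hsum : Tendsto (fun t => ∑ v ∈ I.verts.erase I.cStar, Real.exp (inner ℝ (I.gap v) (w t)))
      atTop (𝓝 (∑ v ∈ I.verts.erase I.cStar, 0)) := by
    refine tendsto_finsetSum _ fun v hv => Real.tendsto_exp_atBot.comp ?_
    have hv' := Finset.mem_erase.1 hv
    have h1 : Tendsto (fun t => (inner ℝ (I.gap v) ((‖w t‖)⁻¹ • w t) : ℝ)) atTop
        (𝓝 (inner ℝ (I.gap v) u)) := tendsto_const_nhds.inner hdir
    refine (hnorm.atTop_mul_neg (hu v hv'.2 hv'.1) h1).congr' ?_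
    filter_upwards [hnorm.eventually_gt_atTop 0] with t ht
    rw [inner_smul_right, mul_inv_cancel_left₀ ht.ne']
  simpa using (hsum.const_add 1).inv₀ (by simp)

end Instance

/-! ### Training loss and margin certificates -/

variable {T : TokenModel Voc d} {N : ℕ} {train : Fin N → Instance T}

theorem trainLoss_eq (htrain : ∀ i, (train i).Admissible) : trainLoss train =
    fun w => (1 / (N : ℝ)) * ∑ i, logSumExp (train i).verts (train i).gap w := by
  funext w
  simp only [trainLoss, (train _).loss_eq (htrain _)]

theorem differentiable_trainLoss (htrain : ∀ i, (train i).Admissible) :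
    Differentiable ℝ (trainLoss train) := by
  rw [trainLoss_eq htrain]
  exact (Differentiable.fun_sum fun i _ =>
    differentiable_logSumExp ⟨_, (train i).cStar_mem_verts⟩ _).const_mul _

theorem trainLoss_add_fderiv_le (htrain : ∀ i, (train i).Admissible)
    (x z : EuclideanSpace ℝ (Fin 2)) :
    trainLoss train x + fderiv ℝ (trainLoss train) x (z - x) ≤ trainLoss train z := by
  have hd : ∀ i : Fin N,
      DifferentiableAt ℝ (logSumExp (train i).verts (train i).gap) x := fun i =>
    differentiable_logSumExp ⟨_, (train i).cStar_mem_verts⟩ _ x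
  rw [trainLoss_eq htrain, fderiv_const_mul (DifferentiableAt.fun_sum fun i _ => hd i),
    fderiv_fun_sum fun i _ => hd i]
  simp only [smul_apply, sum_apply, smul_eq_mul]
  rw [← mul_add, ← Finset.sum_add_distrib]
  refine mul_le_mul_of_nonneg_left (Finset.sum_le_sum fun i _ => ?_) (by positivity)
  exact logSumExp_add_fderiv_le ⟨_, (train i).cStar_mem_verts⟩ _ x z

/-- A certificate that `u` is the maximum-margin direction with margin `g`. -/
structure IsMarginCertificate (train : Fin N → Instance T) (u : EuclideanSpace ℝ (Fin 2))
    (g : ℝ) : Prop where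
  norm_eq : ‖u‖ = 1
  nonneg_zero : 0 ≤ u 0
  nonneg_one : 0 ≤ u 1
  pos : 0 < g
  lower : ∀ i, ∀ v ∈ (train i).verts, v ≠ (train i).cStar → inner ℝ ((train i).gap v) u ≤ -g
  upper : ∀ w : EuclideanSpace ℝ (Fin 2), ∃ i, ∃ v ∈ (train i).verts, v ≠ (train i).cStar ∧
    -(g * inner ℝ w u) ≤ inner ℝ ((train i).gap v) w

namespace IsMarginCertificate

variable {u : EuclideanSpace ℝ (Fin 2)} {g : ℝ}

theorem margin_le [Fintype Voc] (h : IsMarginCertificate train u g) (w : EuclideanSpace ℝ (Fin 2)) :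
    margin train w ≤ g * inner ℝ w u := by
  obtain ⟨i, v, hv, hne, hle⟩ := h.upper w
  refine le_trans (csInf_le ?_ ⟨i, v, hv, hne, rfl⟩) ?_
  · refine ((Set.finite_range fun p : Fin N × Voc =>
      (inner ℝ w ((train p.1).feature (train p.1).cStar - (train p.1).feature p.2) : ℝ)).subset
        ?_).bddBelow
    rintro m ⟨i, v, -, -, rfl⟩
    exact ⟨(i, v), rfl⟩
  · rw [real_inner_comm, ← neg_sub, inner_neg_left]
    exact neg_le.1 hle

theorem le_margin (h : IsMarginCertificate train u g) : g ≤ margin train u := by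
  obtain ⟨i, v, hv, hne, -⟩ := h.upper u
  refine le_csInf ⟨_, i, v, hv, hne, rfl⟩ ?_
  rintro m ⟨i, v, hv, hne, rfl⟩
  rw [real_inner_comm, ← neg_sub, inner_neg_left]
  exact le_neg.1 (h.lower i v hv hne)

theorem isMaxMargin [Fintype Voc] (h : IsMarginCertificate train u g) : IsMaxMargin train u := by
  refine ⟨⟨h.norm_eq, h.nonneg_zero, h.nonneg_one⟩, fun x hx => ?_⟩
  refine (h.margin_le x).trans (le_trans ?_ h.le_margin)
  have h1 := real_inner_le_norm x u
  rw [hx.1, h.norm_eq, one_mul] at h1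
  exact mul_le_of_le_one_right h.pos.le h1

/-- A maximizer satisfies `g ≤ margin train x ≤ g ⟪x, u⟫`, which is the equality case of
Cauchy–Schwarz for unit vectors. -/
theorem eq_of_isMaxMargin [Fintype Voc] (h : IsMarginCertificate train u g) {x : EuclideanSpace ℝ (Fin 2)}
    (hx : IsMaxMargin train x) : x = u := by
  have h1 : margin train u ≤ margin train x := hx.2 h.isMaxMargin.1
  have h2 := (h.le_margin.trans h1).trans (h.margin_le x)
  have h3 : 1 ≤ (inner ℝ x u : ℝ) := by
    by_contra hlt
    exact absurd h2 (not_le.2 (mul_lt_of_lt_one_right h.pos (not_le.1 hlt)))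
  have h4 := real_inner_le_norm x u
  rw [hx.1.1, h.norm_eq, one_mul] at h4
  exact (inner_eq_one_iff_of_norm_eq_one hx.1.1 h.norm_eq).1 (le_antisymm h4 h3)

/-- The training loss is bounded below in terms of the norm of the parameters. -/
theorem le_trainLoss (h : IsMarginCertificate train u g) (htrain : ∀ i, (train i).Admissible)
    (w : EuclideanSpace ℝ (Fin 2)) :
    (1 / (N : ℝ)) * Real.log (1 + Real.exp (-(g * ‖w‖))) ≤ trainLoss train w := by
  obtain ⟨i, v, hv, hne, hle⟩ := h.upper w
  rw [trainLoss_eq htrain]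
  refine mul_le_mul_of_nonneg_left ?_ (by positivity)
  have hS : ∀ j, (1 : ℝ) ≤ ∑ v ∈ (train j).verts, Real.exp (inner ℝ ((train j).gap v) w) := by
    intro j
    rw [(train j).sum_exp_gap_eq]
    have : 0 ≤ ∑ v ∈ (train j).verts.erase (train j).cStar,
        Real.exp (inner ℝ ((train j).gap v) w) := by positivity
    linarith
  refine le_trans ?_ (Finset.single_le_sum
    (f := fun j => logSumExp (train j).verts (train j).gap w)
    (fun j _ => Real.log_nonneg (hS j)) (Finset.mem_univ i))
  refine Real.log_le_log (by positivity) ?_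
  rw [(train i).sum_exp_gap_eq]
  gcongr
  refine le_trans (Real.exp_le_exp.2 (le_trans ?_ hle)) (Finset.single_le_sum
    (f := fun v => Real.exp (inner ℝ ((train i).gap v) w))
    (fun _ _ => (Real.exp_pos _).le) (Finset.mem_erase.2 ⟨hne, hv⟩))
  have h4 := real_inner_le_norm w u
  rw [h.norm_eq, mul_one] at h4
  exact neg_le_neg (mul_le_mul_of_nonneg_left h4 h.pos.le)

/-- The training loss along the maximum-margin ray decays exponentially. -/
theorem trainLoss_smul_le [Fintype Voc] (h : IsMarginCertificate train u g) (hN : 0 < N)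
    (htrain : ∀ i, (train i).Admissible) {s : ℝ} (hs : 0 ≤ s) :
    trainLoss train (s • u) ≤ Fintype.card Voc * Real.exp (-(g * s)) := by
  rw [trainLoss_eq htrain]
  have hN' : (0 : ℝ) < N := Nat.cast_pos.2 hN
  have key : ∀ i : Fin N, logSumExp (train i).verts (train i).gap (s • u)
      ≤ Fintype.card Voc * Real.exp (-(g * s)) := by
    intro i
    -- In `log y ≤ y - 1` the `-1` cancels the contribution of `c⋆`.
    refine (Real.log_le_sub_one_of_pos (sum_exp_inner_pos
      ⟨_, (train i).cStar_mem_verts⟩ _ _)).trans ?_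
    rw [(train i).sum_exp_gap_eq, add_sub_cancel_left]
    refine (Finset.sum_le_card_nsmul _ _ (Real.exp (-(g * s))) fun v hv => ?_).trans ?_
    · have hv' := Finset.mem_erase.1 hv
      rw [inner_smul_right, Real.exp_le_exp]
      have := mul_le_mul_of_nonneg_left (h.lower i v hv'.2 hv'.1) hs
      linarith
    · rw [nsmul_eq_mul]
      gcongr
      exact Finset.card_le_univ _
  calc (1 / (N : ℝ)) * ∑ i, logSumExp (train i).verts (train i).gap (s • u)
      ≤ (1 / (N : ℝ)) * ∑ _i : Fin N, Fintype.card Voc * Real.exp (-(g * s)) := by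
        gcongr with i
        exact key i
    _ = Fintype.card Voc * Real.exp (-(g * s)) := by
        rw [Finset.sum_const, Finset.card_univ, Fintype.card_fin, nsmul_eq_mul]
        field_simp

theorem exists_trainLoss_smul_lt [Fintype Voc] (h : IsMarginCertificate train u g) (hN : 0 < N)
    (htrain : ∀ i, (train i).Admissible) {η : ℝ} (hη : 0 < η) : ∃ z, trainLoss train z < η := by
  have hlim : Tendsto (fun s : ℝ => Fintype.card Voc * Real.exp (-(g * s))) atTop
      (𝓝 (Fintype.card Voc * 0)) :=
    (Real.tendsto_exp_neg_atTop_nhds_zero.comp (tendsto_id.const_mul_atTop h.pos)).const_mul _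
  rw [mul_zero] at hlim
  obtain ⟨s, hs1, hs2⟩ := ((hlim.eventually_lt_const hη).and (eventually_ge_atTop 0)).exists
  exact ⟨s • u, (h.trainLoss_smul_le hN htrain hs2).trans_lt hs1⟩

/-- The extra factor `exp (-g ε ‖x‖)` gained on the longer ray eventually beats the constants
`|Voc|` and `1 / (2N)` separating the upper and lower loss bounds. -/
theorem exists_forall_trainLoss_smul_le [Fintype Voc] (h : IsMarginCertificate train u g) (hN : 0 < N)
    (htrain : ∀ i, (train i).Admissible) {ε : ℝ} (hε : 0 < ε) :
    ∃ R : ℝ, ∀ x, R ≤ ‖x‖ → trainLoss train (((1 + ε) * ‖x‖) • u) ≤ trainLoss train x := by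
  have hN' : (0 : ℝ) < N := Nat.cast_pos.2 hN
  have hlim : Tendsto (fun s : ℝ => Fintype.card Voc * Real.exp (-(g * ε * s))) atTop
      (𝓝 (Fintype.card Voc * 0)) :=
    (Real.tendsto_exp_neg_atTop_nhds_zero.comp
      (tendsto_id.const_mul_atTop (mul_pos h.pos hε))).const_mul _
  rw [mul_zero] at hlim
  obtain ⟨R, hR⟩ := eventually_atTop.1
    (hlim.eventually_lt_const (show (0 : ℝ) < 1 / N * (1 / 2) by positivity))
  refine ⟨R, fun x hx => ?_⟩
  refine le_trans (h.trainLoss_smul_le hN htrain (by positivity))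
    (le_trans ?_ (h.le_trainLoss htrain x))
  set s := Real.exp (-(g * ‖x‖)) with hs
  have hs0 : 0 < s := Real.exp_pos _
  have hs1 : s ≤ 1 := Real.exp_le_one_iff.2 (by have := h.pos; have := norm_nonneg x; nlinarith)
  -- `log (1 + s) ≥ s / (1 + s) ≥ s / 2`, as `s ≤ 1`.
  have hlog : 1 / 2 * s ≤ Real.log (1 + s) := by
    have h1 := Real.one_sub_inv_le_log_of_pos (show 0 < 1 + s by positivity)
    refine le_trans ?_ h1
    rw [show 1 - (1 + s)⁻¹ = s / (1 + s) by field_simp; ring, le_div_iff₀ (by positivity)]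
    nlinarith
  have h2 : Real.exp (-(g * ((1 + ε) * ‖x‖))) = Real.exp (-(g * ε * ‖x‖)) * s := by
    rw [hs, ← Real.exp_add]; ring_nf
  rw [h2, ← mul_assoc]
  calc Fintype.card Voc * Real.exp (-(g * ε * ‖x‖)) * s ≤ 1 / N * (1 / 2) * s :=
        mul_le_mul_of_nonneg_right (hR _ hx).le hs0.le
    _ = 1 / N * (1 / 2 * s) := by ring
    _ ≤ _ := by gcongr

/-- Gradient flow diverges in the maximum-margin direction. -/
theorem tendsto_gradientFlow [Fintype Voc] (h : IsMarginCertificate train u g) (hN : 0 < N)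
    (htrain : ∀ i, (train i).Admissible) {α : ℝ} (hα : 0 < α)
    {w : ℝ → EuclideanSpace ℝ (Fin 2)} (hw : IsGradientFlow (trainLoss train) α w) :
    Tendsto (fun t => ‖w t‖) atTop atTop ∧
      Tendsto (fun t => (‖w t‖)⁻¹ • w t) atTop (𝓝 u) := by
  have hN' : (0 : ℝ) < N := Nat.cast_pos.2 hN
  have hL := differentiable_trainLoss htrain
  have hconv := trainLoss_add_fderiv_le htrain
  have hnorm : Tendsto (fun t => ‖w t‖) atTop atTop := by
    refine tendsto_atTop.2 fun B => ?_
    have hη : 0 < (1 / (N : ℝ)) * Real.log (1 + Real.exp (-(g * B))) :=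
      mul_pos (by positivity) (Real.log_pos (by linarith [Real.exp_pos (-(g * B))]))
    obtain ⟨z, hz⟩ := h.exists_trainLoss_smul_lt hN htrain hη
    filter_upwards [eventually_loss_lt_of_gradientFlow hL hconv hα hw hz] with t ht
    by_contra hlt
    refine absurd ((h.le_trainLoss htrain (w t)).trans_lt ht) (not_lt.2 ?_)
    have := mul_le_mul_of_nonneg_left (not_le.1 hlt).le h.pos.le
    gcongr
  exact ⟨hnorm, tendsto_direction_of_gradientFlow hconv hα hw hnorm h.norm_eq
    fun ε hε => h.exists_forall_trainLoss_smul_le hN htrain hε⟩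

end IsMarginCertificate

/-! ### Extremal weights of the training set -/

section Overshoot

variable {Voc : Type*} [DecidableEq Voc] {d : ℕ} {T : TokenModel Voc d} {N : ℕ}
  {train : Fin N → Instance T}

theorem lamStar_le (i : Fin N) : lamStar train ≤ (train i).weight (train i).cStar :=
  ciInf_le (Set.finite_range _).bddBelow i

theorem exists_eq_lamStar (hN : 0 < N) (train : Fin N → Instance T) :
    ∃ i, (train i).weight (train i).cStar = lamStar train := by
  have : Nonempty (Fin N) := ⟨⟨0, hN⟩⟩
  exact exists_eq_ciInf_of_finite

theorem lamStar_pos (hN : 0 < N) (htrain : ∀ i, (train i).Admissible) : 0 < lamStar train := by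
  obtain ⟨i, hi⟩ := exists_eq_lamStar hN train
  exact hi ▸ (htrain i).weight_pos _ (htrain i).cStar_mem

theorem lamStar_le_one (hN : 0 < N) (htrain : ∀ i, (train i).Admissible) :
    lamStar train ≤ 1 := by
  obtain ⟨i, hi⟩ := exists_eq_lamStar hN train
  exact hi ▸ (htrain i).weight_le_one _ (htrain i).cStar_mem

theorem isGreatest_signedOvershoot [Finite Voc]
    (h : ∃ i, ∃ v ∈ (train i).nbhd, v ≠ (train i).cStar) :
    IsGreatest {x : ℝ | ∃ i, ∃ v ∈ (train i).nbhd, v ≠ (train i).cStar ∧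
      x = (train i).weight v - (train i).weight (train i).cStar} (signedOvershoot train) := by
  obtain ⟨i, v, hv, hne⟩ := h
  have hfin : {x : ℝ | ∃ i, ∃ v ∈ (train i).nbhd, v ≠ (train i).cStar ∧
      x = (train i).weight v - (train i).weight (train i).cStar}.Finite := by
    refine (Set.finite_range fun p : Fin N × Voc =>
      (train p.1).weight p.2 - (train p.1).weight (train p.1).cStar).subset ?_
    rintro x ⟨i, v, -, -, rfl⟩
    exact ⟨(i, v), rfl⟩
  exact ⟨Set.Nonempty.csSup_mem ⟨_, i, v, hv, hne, rfl⟩ hfin,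
    fun x hx => le_csSup hfin.bddAbove hx⟩

theorem deltaTrain_eq_max [Finite Voc]
    (h : ∃ i, ∃ v ∈ (train i).nbhd, v ≠ (train i).cStar) :
    deltaTrain train = max (signedOvershoot train) 0 := by
  have hg := isGreatest_signedOvershoot h
  refine IsGreatest.csSup_eq ⟨?_, ?_⟩
  · obtain ⟨i, v, hv, hne, he⟩ := hg.1
    exact ⟨i, v, hv, hne, by rw [he]⟩
  · rintro x ⟨i, v, hv, hne, rfl⟩
    exact max_le_max_right 0 (hg.2 ⟨i, v, hv, hne, rfl⟩)

end Overshoot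

/-! ### The explicit maximum-margin direction -/

/-- The unit vector of slope `ρ`. -/
noncomputable def slopeDir (ρ : ℝ) : EuclideanSpace ℝ (Fin 2) :=
  (√(1 + ρ ^ 2))⁻¹ • !₂[1, ρ]

theorem slopeDir_zero (ρ : ℝ) : slopeDir ρ 0 = (√(1 + ρ ^ 2))⁻¹ := by
  simp [slopeDir]

theorem slopeDir_one (ρ : ℝ) : slopeDir ρ 1 = (√(1 + ρ ^ 2))⁻¹ * ρ := by
  simp [slopeDir]

theorem norm_slopeDir (ρ : ℝ) : ‖slopeDir ρ‖ = 1 := by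
  have h : 0 < √(1 + ρ ^ 2) := Real.sqrt_pos.2 (by positivity)
  rw [slopeDir, norm_smul, EuclideanSpace.norm_eq, Fin.sum_univ_two, norm_inv,
    Real.norm_of_nonneg h.le]
  simp [inv_mul_cancel₀ h.ne']

theorem inner_slopeDir (w : EuclideanSpace ℝ (Fin 2)) (ρ : ℝ) :
    inner ℝ w (slopeDir ρ) = (√(1 + ρ ^ 2))⁻¹ * (w 0 + ρ * w 1) := by
  simp only [PiLp.inner_apply, Fin.sum_univ_two, slopeDir_zero, slopeDir_one]
  simp
  ring

section Certificate

variable {Voc : Type*} [DecidableEq Voc] {d : ℕ} {T : TokenModel Voc d} {N : ℕ}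
  {train : Fin N → Instance T}

/-- The constraint of the competing candidates and the tight explored constraint, if any, certify
the direction of slope `ρ`. -/
theorem isMarginCertificate_slopeDir (hN : 0 < N) (htrain : ∀ i, (train i).Admissible) {ρ : ℝ}
    (hρ : 0 ≤ ρ)
    (hlow : ∀ i, ∀ v ∈ (train i).nbhd, v ≠ (train i).cStar →
      lamStar train ≤ ρ - ((train i).weight v - (train i).weight (train i).cStar))
    (hup : ρ = 0 ∨ ∃ i, ∃ v ∈ (train i).nbhd, v ≠ (train i).cStar ∧
      ρ = lamStar train + ((train i).weight v - (train i).weight (train i).cStar)) :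
    IsMarginCertificate train (slopeDir ρ) ((√(1 + ρ ^ 2))⁻¹ * lamStar train) := by
  have hs : 0 < (√(1 + ρ ^ 2))⁻¹ := inv_pos.2 (Real.sqrt_pos.2 (by positivity))
  have hl := lamStar_pos hN htrain
  refine ⟨norm_slopeDir ρ, ?_, ?_, mul_pos hs hl, ?_, ?_⟩
  · rw [slopeDir_zero]; exact hs.le
  · rw [slopeDir_one]; exact mul_nonneg hs.le hρ
  · intro i v hv hne
    have hc := lamStar_le (train := train) i
    by_cases hcand : (train i).IsCand v
    · rw [(train i).inner_gap_of_isCand (htrain i) hne hcand, slopeDir_zero]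
      exact neg_le_neg (mul_le_mul_of_nonneg_left hc hs.le)
    · rw [(train i).inner_gap_of_not_isCand hcand, slopeDir_zero, slopeDir_one, ← mul_sub]
      refine neg_le_neg (mul_le_mul_of_nonneg_left ?_ hs.le)
      by_cases hn : v ∈ (train i).nbhd
      · exact hlow i v hn hne
      -- An unexplored non-candidate has margin proportional to `ρ + λ_{c⋆} ≥ λ⋆`.
      · rw [(htrain i).weight_eq_zero v hn]
        linarith
  · intro w
    obtain ⟨i₀, hi₀⟩ := exists_eq_lamStar hN train
    obtain ⟨v₀, hv₀, hne₀, hcand₀⟩ := (train i₀).exists_isCand_ne_cStar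
    have hk : (√(1 + ρ ^ 2))⁻¹ * lamStar train * inner ℝ w (slopeDir ρ)
        = lamStar train / (1 + ρ ^ 2) * (w 0 + ρ * w 1) := by
      have hsq : (√(1 + ρ ^ 2))⁻¹ * (√(1 + ρ ^ 2))⁻¹ = (1 + ρ ^ 2)⁻¹ := by
        rw [← mul_inv, Real.mul_self_sqrt (by positivity)]
      rw [inner_slopeDir, div_eq_mul_inv, ← hsq]
      ring
    rw [hk]
    set k := lamStar train / (1 + ρ ^ 2) with hkdef
    have hlk : lamStar train = k * (1 + ρ ^ 2) := by rw [hkdef]; field_simp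
    by_cases hcase : w 0 * lamStar train ≤ k * (w 0 + ρ * w 1)
    · refine ⟨i₀, v₀, hv₀, hne₀, ?_⟩
      rw [(train i₀).inner_gap_of_isCand (htrain i₀) hne₀ hcand₀, hi₀]
      exact neg_le_neg hcase
    rcases hup with rfl | ⟨i, v, hv, hne, he⟩
    · exact absurd (by simp [hkdef, mul_comm]) hcase
    refine ⟨i, v, (train i).nbhd_subset_verts hv, hne, ?_⟩
    rw [(train i).inner_gap_of_not_isCand ((train i).not_isCand_of_mem_nbhd hv hne),
      eq_sub_iff_add_eq'.2 he.symm]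
    refine neg_le_neg ?_
    by_contra hcon
    -- Weights at most `1` enter here: `λ⋆ ρ ≤ ρ ≤ 1 + ρ ^ 2`, so `1 - k ρ` and `k ρ` are convex
    -- weights.
    have hkρ : k * ρ ≤ 1 := by
      rw [hkdef, div_mul_eq_mul_div, div_le_one (by positivity)]
      have := mul_le_mul_of_nonneg_right (lamStar_le_one hN htrain) hρ
      nlinarith [sq_nonneg (ρ - 1)]
    have hkρ0 : 0 ≤ k * ρ := by positivity
    -- Dual identity: the two tight margins average to `g ⟪w, u⟫`, so they cannot both exceed it.
    have hsum : (1 - k * ρ) * (w 0 * lamStar train)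
        + k * ρ * (w 1 - w 0 * (ρ - lamStar train)) = k * (w 0 + ρ * w 1) := by
      linear_combination (w 0) * hlk
    rw [not_le] at hcase hcon
    rcases hkρ0.eq_or_lt with h0 | h0
    · rw [← h0] at hsum
      linarith
    · nlinarith [mul_pos h0 (sub_pos.2 hcon),
        mul_nonneg (sub_nonneg.2 hkρ) (sub_pos.2 hcase).le]

end Certificate

end PredictionStage

/-! ### Main theorem -/

theorem mainTheorem3 {Voc : Type*} [Fintype Voc] [DecidableEq Voc] {d : ℕ}
    (T : PredictionStage.TokenModel Voc d) {N : ℕ} (hN : 0 < N)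
    (train : Fin N → PredictionStage.Instance T) (htrain : ∀ i, (train i).Admissible)
    (α : ℝ) (hα : 0 < α) (w : ℝ → EuclideanSpace ℝ (Fin 2))
    (hw : PredictionStage.IsGradientFlow (PredictionStage.trainLoss train) α w) :
    ∃ u : EuclideanSpace ℝ (Fin 2),
      (PredictionStage.IsMaxMargin train u ∧
        ∀ u', PredictionStage.IsMaxMargin train u' → u' = u) ∧
      Tendsto (fun t => ‖w t‖) atTop atTop ∧
      Tendsto (fun t => (‖w t‖)⁻¹ • w t) atTop (𝓝 u) ∧
      -- non-degeneracy of the training set, automatic if no reachable candidate is a root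
      ((∃ i, ∃ v ∈ (train i).nbhd, v ≠ (train i).cStar ∧
          (train i).weight (train i).cStar - (train i).weight v
            < PredictionStage.lamStar train) →
        0 < u 0 ∧ 0 < u 1 ∧
        u 1 / u 0 = PredictionStage.lamStar train + PredictionStage.signedOvershoot train ∧
        ((∃ i, ∃ v ∈ (train i).nbhd, v ≠ (train i).cStar ∧
            (train i).weight (train i).cStar ≤ (train i).weight v) →
          u 1 / u 0 = PredictionStage.lamStar train + PredictionStage.deltaTrain train) ∧
        ∀ I : PredictionStage.Instance T, I.Admissible →
          (∀ v ∈ I.verts,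
            I.weight v - I.weight I.cStar ≤ PredictionStage.deltaTrain train) →
          Tendsto (fun t => I.prob (w t)) atTop (𝓝 1)) := by
  open PredictionStage in
  have hl := lamStar_pos hN htrain
  by_cases hnd : ∃ i, ∃ v ∈ (train i).nbhd, v ≠ (train i).cStar ∧
      (train i).weight (train i).cStar - (train i).weight v < lamStar train
  · obtain ⟨i, v, hv, hne, hlt⟩ := hnd
    have hex : ∃ i, ∃ v ∈ (train i).nbhd, v ≠ (train i).cStar := ⟨i, v, hv, hne⟩
    have hg := isGreatest_signedOvershoot hex
    have hδ := hg.2 ⟨i, v, hv, hne, rfl⟩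
    set ρ := lamStar train + signedOvershoot train with hρdef
    -- Non-degeneracy says precisely that some overshoot exceeds `-λ⋆`.
    have hρ : 0 < ρ := by linarith
    have hs : 0 < (√(1 + ρ ^ 2))⁻¹ := inv_pos.2 (Real.sqrt_pos.2 (by positivity))
    have hcert := isMarginCertificate_slopeDir hN htrain hρ.le
      (fun j x hx hxne => by linarith [hg.2 ⟨j, x, hx, hxne, rfl⟩])
      (Or.inr <| by
        obtain ⟨j, x, hx, hxne, he⟩ := hg.1
        exact ⟨j, x, hx, hxne, by rw [hρdef, he]⟩)
    obtain ⟨hnorm, hdir⟩ := hcert.tendsto_gradientFlow hN htrain hα hw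
    have hslope : slopeDir ρ 1 / slopeDir ρ 0 = ρ := by
      rw [slopeDir_zero, slopeDir_one, mul_div_cancel_left₀ _ hs.ne']
    refine ⟨slopeDir ρ, ⟨hcert.isMaxMargin, fun _ => hcert.eq_of_isMaxMargin⟩, hnorm, hdir,
      fun _ => ⟨?_, ?_, hslope, ?_, ?_⟩⟩
    · rw [slopeDir_zero]; exact hs
    · rw [slopeDir_one]; exact mul_pos hs hρ
    · rintro ⟨j, x, hx, hxne, hle⟩
      rw [hslope, deltaTrain_eq_max hex, max_eq_left]
      linarith [hg.2 ⟨j, x, hx, hxne, rfl⟩]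
    · intro I hI hover
      refine I.tendsto_prob hI hnorm hdir fun x hx hxne => ?_
      by_cases hcand : I.IsCand x
      · rw [I.inner_gap_of_isCand hI hxne hcand, slopeDir_zero, neg_lt_zero]
        exact mul_pos hs (hI.weight_pos _ hI.cStar_mem)
      · rw [I.inner_gap_of_not_isCand hcand, slopeDir_zero, slopeDir_one, ← mul_sub,
          neg_lt_zero]
        refine mul_pos hs ?_
        have h1 := hover x hx
        rw [deltaTrain_eq_max hex] at h1
        -- If `δ ≥ 0` the remaining margin is at least `λ⋆`; if `δ < 0` the unseen overshoot is at
        -- most `0` and the margin at least `ρ`.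
        rcases max_cases (signedOvershoot train) 0 with h2 | h2 <;> linarith
  -- In the degenerate case every explored competitor already has margin at least `λ⋆` at slope `0`,
  -- so `u = (1, 0)`.
  · have hcert := isMarginCertificate_slopeDir hN htrain le_rfl
      (fun j x hx hxne => by
        by_contra hcon
        exact hnd ⟨j, x, hx, hxne, by linarith⟩)
      (Or.inl rfl)
    obtain ⟨hnorm, hdir⟩ := hcert.tendsto_gradientFlow hN htrain hα hw
    exact ⟨slopeDir 0, ⟨hcert.isMaxMargin, fun _ => hcert.eq_of_isMaxMargin⟩, hnorm, hdir,
      fun h => absurd h hnd⟩
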